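/- Consider a source at an unknown point $\theta=(x,y)\in\mathbb R^2$ and sensors at points $\psi_m=(a_m,b_m)\in\mathbb R^2$, $m\in\mathbb N$. The signal received at sensor $m$ is $r_m(t)=k_0D_m^{-\gamma/2}s(t-D_m/c)+v_m(t)$, where $D_m=\sqrt{(x-a_m)^2+(y-b_m)^2}$, $k_0\neq 0$ is a gain constant, $\gamma>2$ is the path-loss exponent, $c>0$ is the propagation speed, $v_m$ is white Gaussian noise of spectral density $N_0/2>0$, and $s:\mathbb R\to\mathbb R$ is a known differentiable waveform, not identically zero, such that $s$ and $s'$ are square integrable. Let $\phi_m$ be the angle with $\cos\phi_m=(x-a_m)/D_m$ and $\sin\phi_m=(y-b_m)/D_m$, and put $$E_s=k_0^2\int_{-\infty}^\infty s(t)^2\,dt,\qquad \rho=\frac{E_s}{2N_0},\qquad W_e=\frac{k_0^2}{E_s}\int_{-\infty}^\infty s'(t)^2\,dt,\qquad g(D)=D^{-\gamma-2}\Bigl(\gamma^2+\frac{4W_e}{c^2}D^2\Bigr).$$ The Cramér–Rao bound for given sensor locations $\psi=(\psi_m)_m$ is $$\mathrm{CRB}(\theta,\psi)=\frac1\rho\,\frac{\sum_m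 g(D_m)}{\sum_m\sum_{j>m}g(D_m)g(D_j)\sin^2(\phi_m-\phi_j)}.$$ Theorem. Let $\Psi=(\Psi_m)_m$ be the points of a homogeneous Poisson point process on $\mathbb R^2$ with density $\lambda>0$. Then for every $\theta\in\mathbb R^2$ the average Cramér–Rao bound (an expectation in $[0,\infty]$) satisfies $$\mathbb E[\mathrm{CRB}(\theta,\Psi)]\;\ge\;\mathrm{CRB}_{\mathrm{LB}}:=\frac4\rho\int_0^\infty e^{-2\pi\lambda Z(s)}\,ds,\qquad Z(s)=\int_0^\infty\bigl(1-e^{-s\,g(r)}\bigr)\,r\,dr,$$ where the integral defining $Z(s)$ converges for every $s>0$ and the integral defining $\mathrm{CRB}_{\mathrm{LB}}$ is finite. -/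

import Mathlib

open MeasureTheory ProbabilityTheory Set
open scoped ENNReal NNReal

noncomputable section

/-- The Euclidean plane, in which the source and the sensors lie. -/
abbrev Plane : Type := EuclideanSpace ℝ (Fin 2)

/-- The number (with multiplicity, possibly infinite) of terms of the sequence `ψ` in `B`. -/
def pointCount (ψ : ℕ → Plane) (B : Set Plane) : ℕ∞ :=
  {m : ℕ | ψ m ∈ B}.encard

/-- The random points `Ψ 0, Ψ 1, …` enumerate a homogeneous Poisson point process on the plane
with `lam` points per unit area: the number of points in a Borel set `B` of finite area is Poisson
with mean `lam * area B`, and the numbers of points in disjoint Borel sets are independent. -/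
structure IsHomogeneousPPP {Ω : Type*} [MeasurableSpace Ω] (P : Measure Ω) (lam : ℝ)
    (Ψ : ℕ → Ω → Plane) : Prop where
  measurable : ∀ m, Measurable (Ψ m)
  poisson : ∀ B : Set Plane, MeasurableSet B → volume B < ∞ →
    HasLaw (fun ω => pointCount (fun m => Ψ m ω) B)
      ((poissonMeasure (ENNReal.ofReal lam * volume B).toNNReal).map (fun n : ℕ => (n : ℕ∞))) P
  indep : ∀ (n : ℕ) (B : Fin n → Set Plane), (∀ i, MeasurableSet (B i)) →
    (∀ i, volume (B i) < ∞) → Pairwise (fun i j => Disjoint (B i) (B j)) →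
    iIndepFun (fun i ω => pointCount (fun m => Ψ m ω) (B i)) P

/-- The data of the received signals `r_m(t) = k₀ D_m ^ (-γ/2) s(t - D_m / c) + v_m(t)`, where
`v_m` is white Gaussian noise of spectral density `N₀ / 2`. -/
structure SignalModel where
  /-- the transmitted waveform -/
  s : ℝ → ℝ
  /-- the gain constant -/
  k₀ : ℝ
  /-- twice the noise spectral density -/
  N₀ : ℝ
  /-- the propagation speed -/
  c : ℝ
  /-- the path-loss exponent -/
  γ : ℝ
  k₀_ne : k₀ ≠ 0
  N₀_pos : 0 < N₀
  c_pos : 0 < c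
  two_lt_γ : 2 < γ
  differentiable_s : Differentiable ℝ s
  integrable_sq : Integrable (fun t => s t ^ 2)
  integrable_deriv_sq : Integrable (fun t => deriv s t ^ 2)
  integral_sq_pos : 0 < ∫ t, s t ^ 2

namespace SignalModel

variable (M : SignalModel)

/-- The received signal energy `E_s` at unit distance. -/
def Es : ℝ := M.k₀ ^ 2 * ∫ t, M.s t ^ 2

/-- The signal-to-noise ratio `ρ = E_s / (2 N₀)`. -/
def rho : ℝ := M.Es / (2 * M.N₀)

/-- The effective bandwidth `W_e`. -/
def We : ℝ := M.k₀ ^ 2 / M.Es * ∫ t, deriv M.s t ^ 2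

/-- `g(D) = D ^ (-γ - 2) (γ ^ 2 + (4 W_e / c ^ 2) D ^ 2)`. -/
def g (D : ℝ) : ℝ := D ^ (-M.γ - 2) * (M.γ ^ 2 + 4 * M.We / M.c ^ 2 * D ^ 2)

/-- `Z(s) = ∫_0^∞ (1 - exp (-s g(r))) r dr`. -/
def Z (s : ℝ) : ℝ := ∫ r in Ioi (0 : ℝ), (1 - Real.exp (-(s * M.g r))) * r

/-- `CRB_LB = (4 / ρ) ∫_0^∞ exp (-2 π lam Z(s)) ds`. -/
def CRBLB (lam : ℝ) : ℝ :=
  4 / M.rho * ∫ s in Ioi (0 : ℝ), Real.exp (-(2 * Real.pi * lam * M.Z s))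

end SignalModel

/-- The distance `D` between the source `θ` and a sensor at `p`. -/
def sourceDist (θ p : Plane) : ℝ := Real.sqrt ((θ 0 - p 0) ^ 2 + (θ 1 - p 1) ^ 2)

/-- The angle `φ` between the source `θ` and a sensor at `p`. -/
def sourceAngle (θ p : Plane) : ℝ := Complex.arg ⟨θ 0 - p 0, θ 1 - p 1⟩

/-- The angle is the one determined by its cosine and sine. -/
theorem cos_sin_sourceAngle (θ p : Plane) (h : θ ≠ p) :
    Real.cos (sourceAngle θ p) = (θ 0 - p 0) / sourceDist θ p ∧
      Real.sin (sourceAngle θ p) = (θ 1 - p 1) / sourceDist θ p := by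
  have hn : ‖(⟨θ 0 - p 0, θ 1 - p 1⟩ : ℂ)‖ = sourceDist θ p := by
    rw [sourceDist, Complex.norm_def, Complex.normSq_mk]
    congr 1
    ring
  have hz : (⟨θ 0 - p 0, θ 1 - p 1⟩ : ℂ) ≠ 0 := by
    intro h0
    apply h
    have h1 := congrArg Complex.re h0
    have h2 := congrArg Complex.im h0
    simp only [Complex.zero_re, Complex.zero_im] at h1 h2
    ext i
    fin_cases i
    · simpa using sub_eq_zero.mp h1
    · simpa using sub_eq_zero.mp h2
  constructor
  · rw [sourceAngle, Complex.cos_arg hz, hn]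
  · rw [sourceAngle, Complex.sin_arg, hn]

namespace SignalModel

variable (M : SignalModel)

/-- The Cramér–Rao bound for the source location `θ` and the sensor locations `ψ`:
`(1 / ρ) (∑_m g(D_m)) / (∑_m ∑_{j > m} g(D_m) g(D_j) sin² (φ_m - φ_j))`. It is computed in
`[0, ∞]`, so that it is infinite if all sensors lie on one line through the source. -/
def CRB (θ : Plane) (ψ : ℕ → Plane) : ℝ≥0∞ :=
  ENNReal.ofReal (1 / M.rho) *
    ((∑' m, ENNReal.ofReal (M.g (sourceDist θ (ψ m)))) /
      ∑' m, ∑' j, if m < j then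
        ENNReal.ofReal (M.g (sourceDist θ (ψ m)) * M.g (sourceDist θ (ψ j)) *
          Real.sin (sourceAngle θ (ψ m) - sourceAngle θ (ψ j)) ^ 2)
      else 0)

/-- The average Cramér–Rao bound `E[CRB(θ, Ψ)]`, an expectation in `[0, ∞]`. -/
def averageCRB {Ω : Type*} [MeasurableSpace Ω] (P : Measure Ω) (Ψ : ℕ → Ω → Plane)
    (θ : Plane) : ℝ≥0∞ :=
  ∫⁻ ω, M.CRB θ (fun m => Ψ m ω) ∂P

end SignalModel

end

/-!
The average Cramér–Rao bound is bounded below by replacing the denominator by a simple majorant.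
Write `w m = g (D_m)` and `A = ∑ w m`. Since `sin² x = (1 - cos 2x) / 2`, the sum of
`w m * w j * sin² (φ_m - φ_j)` over ordered pairs is `(A² - |∑ w m * exp (2 i φ_m)|²) / 2 ≤ A² / 2`,
so the sum over unordered pairs is at most `A² / 4` (`four_mul_tsum_sin_sq_le`). Hence the bound is
at least `(4 / ρ) / A` for every configuration with `A ≠ 0` (`SignalModel.le_CRB`), which is almost
every one because almost surely no sensor sits at the source.

Then `E[1 / A] = ∫_0^∞ E[exp (-s A)] ds` by Tonelli and `lintegral_expNeg_mul`, and `E[exp (-s A)]`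
is the Laplace functional of the Poisson process at `s * g (D)`
(`IsHomogeneousPPP.lintegral_expNeg_tsum`):
`E[exp (-∑ f (Ψ_m))] = exp (-lam * ∫ (1 - exp (-f x)) dx)`. For a simple function `f` this is
independence of the counts in its level sets together with the generating function of the Poisson
law; the general case is a monotone limit. In polar coordinates around the source the exponent is
`2 π lam Z(s)`.

`Z(s)` converges at infinity because `γ > 2`, and `Z(s) ≥ C s ^ (2 / (γ + 2))`
(`SignalModel.le_Z`), which makes the outer integral finite.
-/

open Filter Topology

/-! ### The exponential `exp (-x)` on `[0, ∞]` -/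

/-- The function `x ↦ exp (-x)` on `[0, ∞]`, with `exp (-∞) = 0`. -/
noncomputable def expNeg (x : ℝ≥0∞) : ℝ≥0∞ := EReal.exp (-(x : EReal))

theorem continuous_expNeg : Continuous expNeg :=
  ENNReal.continuous_exp.comp (continuous_neg.comp continuous_coe_ennreal_ereal)

@[fun_prop]
theorem measurable_expNeg : Measurable expNeg := continuous_expNeg.measurable

theorem antitone_expNeg : Antitone expNeg := fun _ _ h =>
  EReal.exp_monotone (EReal.neg_le_neg_iff.2 (EReal.coe_ennreal_le_coe_ennreal_iff.2 h))

theorem expNeg_zero : expNeg 0 = 1 := by simp [expNeg]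

theorem expNeg_top : expNeg ∞ = 0 := by simp [expNeg]

theorem expNeg_le_one (x : ℝ≥0∞) : expNeg x ≤ 1 :=
  expNeg_zero ▸ antitone_expNeg (zero_le : 0 ≤ x)

theorem expNeg_ofReal {x : ℝ} (hx : 0 ≤ x) :
    expNeg (ENNReal.ofReal x) = ENNReal.ofReal (Real.exp (-x)) := by
  rw [expNeg, EReal.coe_ennreal_ofReal, max_eq_left hx, ← EReal.coe_neg, EReal.exp_coe]

theorem expNeg_add (x y : ℝ≥0∞) : expNeg (x + y) = expNeg x * expNeg y := by
  induction x with
  | top => simp [expNeg_top]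
  | coe x =>
    induction y with
    | top => simp [expNeg_top]
    | coe y =>
      rw [← ENNReal.coe_add, ← ENNReal.ofReal_coe_nnreal, ← ENNReal.ofReal_coe_nnreal,
        ← ENNReal.ofReal_coe_nnreal, expNeg_ofReal (by positivity), expNeg_ofReal (by positivity),
        expNeg_ofReal (by positivity), ← ENNReal.ofReal_mul (by positivity), ← Real.exp_add]
      congr 2
      push_cast
      ring

theorem expNeg_sum {ι : Type*} (s : Finset ι) (f : ι → ℝ≥0∞) :
    expNeg (∑ i ∈ s, f i) = ∏ i ∈ s, expNeg (f i) := by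
  classical
  induction s using Finset.induction_on with
  | empty => simp [expNeg_zero]
  | insert a s ha ih => rw [Finset.sum_insert ha, Finset.prod_insert ha, expNeg_add, ih]

theorem one_sub_expNeg_ofReal {x : ℝ} (hx : 0 ≤ x) :
    1 - expNeg (ENNReal.ofReal x) = ENNReal.ofReal (1 - Real.exp (-x)) := by
  rw [expNeg_ofReal hx, ENNReal.ofReal_sub _ (Real.exp_nonneg _), ENNReal.ofReal_one]

/-- Integrating `exp (-s a)` over `s > 0` gives `1 / a`, also for `a = 0` and `a = ∞`. -/
theorem lintegral_expNeg_mul (a : ℝ≥0∞) :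
    ∫⁻ s in Ioi (0 : ℝ), expNeg (ENNReal.ofReal s * a) = a⁻¹ := by
  induction a with
  | top =>
    rw [setLIntegral_congr_fun (g := fun _ => 0) measurableSet_Ioi]
    · simp
    · intro s (hs : 0 < s)
      simp [ENNReal.mul_top, hs, expNeg_top]
  | coe a =>
    rcases eq_or_ne a 0 with rfl | ha
    · simp [expNeg_zero]
    have ha' : 0 < (a : ℝ) := by exact_mod_cast pos_iff_ne_zero.2 ha
    rw [setLIntegral_congr_fun (g := fun s => ENNReal.ofReal (Real.exp (-(a : ℝ) * s)))
      measurableSet_Ioi, ← ofReal_integral_eq_lintegral_ofReal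
        (integrableOn_exp_mul_Ioi (neg_neg_iff_pos.2 ha') 0) (ae_of_all _ fun _ => Real.exp_nonneg _),
      integral_exp_mul_Ioi (neg_neg_iff_pos.2 ha')]
    · rw [mul_zero, Real.exp_zero, neg_div_neg_eq, one_div, ENNReal.ofReal_inv_of_pos ha',
        ENNReal.ofReal_coe_nnreal]
    · intro s (hs : 0 < s)
      dsimp only
      rw [← ENNReal.ofReal_coe_nnreal (p := a), ← ENNReal.ofReal_mul hs.le,
        expNeg_ofReal (by positivity)]
      congr 2
      ring

/-! ### The Laplace functional of a Poisson process -/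

/-- The Laplace transform of the Poisson law. -/
theorem lintegral_expNeg_mul_poissonMeasure (r : ℝ≥0) {v : ℝ≥0∞} (hv : v ≠ ∞) :
    ∫⁻ n : ℕ, expNeg (v * n) ∂poissonMeasure r = expNeg (r * (1 - expNeg v)) := by
  lift v to ℝ≥0 using hv
  have hle : Real.exp (-(v : ℝ)) ≤ 1 := Real.exp_le_one_iff.2 (by simp)
  rw [← ENNReal.ofReal_coe_nnreal (p := v), one_sub_expNeg_ofReal v.coe_nonneg,
    ← ENNReal.ofReal_coe_nnreal (p := r), ← ENNReal.ofReal_mul r.coe_nonneg,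
    expNeg_ofReal (mul_nonneg r.coe_nonneg (sub_nonneg.2 hle)), poissonMeasure, lintegral_sum_measure]
  have hs := (NormedSpace.expSeries_div_hasSum_exp ((r : ℝ) * Real.exp (-(v : ℝ)))).mul_left
    (Real.exp (-(r : ℝ)))
  rw [← Real.exp_eq_exp_ℝ, ← Real.exp_add] at hs
  have hterm (n : ℕ) :
      ∫⁻ k : ℕ, expNeg (ENNReal.ofReal v * k) ∂ENNReal.ofReal (Real.exp (-r) * r ^ n / n.factorial) •
        Measure.dirac n =
      ENNReal.ofReal (Real.exp (-r) * ((r * Real.exp (-v)) ^ n / n.factorial)) := by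
    rw [lintegral_smul_measure, lintegral_dirac, smul_eq_mul, ← ENNReal.ofReal_natCast,
      ← ENNReal.ofReal_mul v.coe_nonneg, expNeg_ofReal (by positivity), ← ENNReal.ofReal_mul (by positivity),
      mul_pow, ← Real.exp_nat_mul]
    congr 1
    rw [show (n : ℝ) * -(v : ℝ) = -(v * n) by ring]
    ring
  simp_rw [hterm]
  rw [← ENNReal.ofReal_tsum_of_nonneg (fun n => by positivity) hs.summable, hs.tsum_eq]
  congr 2
  ring

theorem tsum_indicator_eq_pointCount (ψ : ℕ → Plane) (B : Set Plane) :
    ∑' m, B.indicator (1 : Plane → ℝ≥0∞) (ψ m) = (pointCount ψ B : ℝ≥0∞) := by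
  rw [pointCount, ← ENNReal.tsum_set_one, tsum_subtype {m | ψ m ∈ B} fun _ => (1 : ℝ≥0∞)]
  rfl

/-- A sum of a simple function over a point configuration is a finite combination of counts. The
level set of the value `0`, which may have infinite area, does not enter. -/
theorem tsum_simpleFunc_eq (f : SimpleFunc Plane ℝ≥0∞) (ψ : ℕ → Plane) :
    ∑' m, f (ψ m) = ∑ v ∈ f.range.erase 0, v * (pointCount ψ (f ⁻¹' {v}) : ℝ≥0∞) := by
  have h (x : Plane) :
      f x = ∑ v ∈ f.range.erase 0, v * (f ⁻¹' {v}).indicator (1 : Plane → ℝ≥0∞) x := by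
    rw [Finset.sum_erase _ (zero_mul _), Finset.sum_eq_single (f x)]
    · simp
    · intro v _ hv
      simp [hv.symm]
    · intro hx
      exact absurd (f.mem_range_self x) hx
  calc
    _ = ∑' m, ∑ v ∈ f.range.erase 0, v * (f ⁻¹' {v}).indicator (1 : Plane → ℝ≥0∞) (ψ m) :=
      tsum_congr fun m => h (ψ m)
    _ = _ := by
      rw [Summable.tsum_finsetSum fun _ _ => ENNReal.summable]
      simp_rw [ENNReal.tsum_mul_left, tsum_indicator_eq_pointCount]

namespace IsHomogeneousPPP

variable {Ω : Type*} [MeasurableSpace Ω] {P : Measure Ω} {lam : ℝ} {Ψ : ℕ → Ω → Plane}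

theorem measurable_pointCount (hΨ : IsHomogeneousPPP P lam Ψ) {B : Set Plane}
    (hB : MeasurableSet B) :
    Measurable fun ω => (pointCount (fun m => Ψ m ω) B : ℝ≥0∞) := by
  simp_rw [← tsum_indicator_eq_pointCount]
  exact Measurable.tsum fun m =>
    (measurable_one.indicator hB).comp (hΨ.measurable m)

theorem lintegral_expNeg_mul_pointCount (hΨ : IsHomogeneousPPP P lam Ψ) {B : Set Plane}
    (hB : MeasurableSet B) (hB' : volume B < ∞) {v : ℝ≥0∞} (hv : v ≠ ∞) :
    ∫⁻ ω, expNeg (v * (pointCount (fun m => Ψ m ω) B : ℝ≥0∞)) ∂P =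
      expNeg (ENNReal.ofReal lam * volume B * (1 - expNeg v)) := by
  rw [(hΨ.poisson B hB hB').lintegral_comp (f := fun n : ℕ∞ => expNeg (v * (n : ℝ≥0∞)))
      (Measurable.of_discrete).aemeasurable,
    lintegral_map Measurable.of_discrete Measurable.of_discrete]
  simp only [ENat.toENNReal_coe]
  rw [lintegral_expNeg_mul_poissonMeasure _ hv,
    ENNReal.coe_toNNReal (ENNReal.mul_ne_top ENNReal.ofReal_ne_top hB'.ne)]

theorem lintegral_expNeg_tsum_simpleFunc (hΨ : IsHomogeneousPPP P lam Ψ)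
    (f : SimpleFunc Plane ℝ≥0∞) (hf : ∀ x, f x ≠ ∞)
    (hfin : ∀ v ≠ 0, volume (f ⁻¹' {v}) < ∞) :
    ∫⁻ ω, expNeg (∑' m, f (Ψ m ω)) ∂P =
      expNeg (ENNReal.ofReal lam * ∫⁻ x, (1 - expNeg (f x))) := by
  set S := f.range.erase 0 with hS
  have hne (v : S) : (v : ℝ≥0∞) ≠ 0 := Finset.ne_of_mem_erase v.2
  have hcount (v : ℝ≥0∞) := hΨ.measurable_pointCount (f.measurableSet_fiber v)
  have hindep : iIndepFun
      (fun (v : S) ω => pointCount (fun m => Ψ m ω) (f ⁻¹' {(v : ℝ≥0∞)})) P := by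
    have h := hΨ.indep _ (fun i => f ⁻¹' {((S.equivFin.symm i : S) : ℝ≥0∞)})
      (fun i => f.measurableSet_fiber _) (fun i => hfin _ (hne _)) (fun i j hij => by
        refine Disjoint.preimage _ (disjoint_singleton.2 fun h => hij ?_)
        exact S.equivFin.symm.injective (Subtype.ext h))
    simpa using h.precomp S.equivFin.injective
  have hindep' : iIndepFun (fun (v : S) ω =>
      expNeg (v * (pointCount (fun m => Ψ m ω) (f ⁻¹' {(v : ℝ≥0∞)}) : ℝ≥0∞))) P :=
    hindep.comp (fun (v : S) (n : ℕ∞) => expNeg ((v : ℝ≥0∞) * (n : ℝ≥0∞)))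
      fun _ => Measurable.of_discrete
  have hint : ∫⁻ x, (1 - expNeg (f x)) = ∑ v ∈ S, (1 - expNeg v) * volume (f ⁻¹' {v}) := by
    have h := (f.map fun v => 1 - expNeg v).lintegral_eq_lintegral volume
    rw [SimpleFunc.map_lintegral] at h
    rw [hS, Finset.sum_erase _ (by simp [expNeg_zero]), ← h]
    rfl
  simp_rw [tsum_simpleFunc_eq, expNeg_sum, ← hS]
  rw [hint, Finset.mul_sum, expNeg_sum]
  simp_rw [← Finset.prod_coe_sort S]
  rw [lintegral_prod_eq_prod_lintegral_of_indepFun _ _ hindep' fun v =>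
    measurable_expNeg.comp ((hcount v).const_mul _)]
  refine Finset.prod_congr rfl fun v _ => ?_
  obtain ⟨x, hx⟩ := SimpleFunc.mem_range.1 (Finset.mem_of_mem_erase v.2)
  rw [hΨ.lintegral_expNeg_mul_pointCount (f.measurableSet_fiber _) (hfin _ (hne v)) (hx ▸ hf x)]
  congr 1
  ring

/-- The Laplace functional of a homogeneous Poisson point process: both sides are continuous along
the increasing approximation of `f` by simple functions supported in balls. -/
theorem lintegral_expNeg_tsum [IsProbabilityMeasure P] (hΨ : IsHomogeneousPPP P lam Ψ)
    {f : Plane → ℝ≥0∞} (hf : Measurable f) :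
    ∫⁻ ω, expNeg (∑' m, f (Ψ m ω)) ∂P =
      expNeg (ENNReal.ofReal lam * ∫⁻ x, (1 - expNeg (f x))) := by
  let F (n : ℕ) : SimpleFunc Plane ℝ≥0∞ :=
    (SimpleFunc.eapprox f n).restrict (Metric.ball 0 n)
  have hF (n : ℕ) (x : Plane) :
      F n x = (Metric.ball 0 (n : ℝ)).indicator (SimpleFunc.eapprox f n) x := by
    rw [SimpleFunc.restrict_apply _ measurableSet_ball]
  have hmono (x : Plane) : Monotone fun n => F n x := by
    intro m n hmn
    simp only [hF]
    by_cases hx : x ∈ Metric.ball (0 : Plane) m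
    · rw [indicator_of_mem hx,
        indicator_of_mem (Metric.ball_subset_ball (by exact_mod_cast hmn) hx)]
      exact SimpleFunc.monotone_eapprox f hmn x
    · rw [indicator_of_notMem hx]
      exact zero_le
  have hlim (x : Plane) : Tendsto (fun n => F n x) atTop (𝓝 (f x)) := by
    refine (SimpleFunc.tendsto_eapprox hf x).congr' ?_
    obtain ⟨N, hN⟩ := exists_nat_gt ‖x‖
    filter_upwards [eventually_ge_atTop N] with n hn
    rw [hF, indicator_of_mem]
    rw [mem_ball_zero_iff]
    exact hN.trans_le (by exact_mod_cast hn)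
  have hsimple (n : ℕ) := hΨ.lintegral_expNeg_tsum_simpleFunc (F n)
    (fun x => by
      rw [hF]
      exact ((indicator_le_self _ _ x).trans_lt (SimpleFunc.eapprox_lt_top f n x)).ne)
    (fun v hv => by
      refine (measure_mono fun x hx => ?_).trans_lt
        (measure_ball_lt_top (μ := volume) (x := (0 : Plane)) (r := n))
      by_contra h
      rw [mem_preimage, hF, indicator_of_notMem h] at hx
      exact hv hx.symm)
  have hsum (ω : Ω) : Tendsto (fun n => ∑' m, F n (Ψ m ω)) atTop (𝓝 (∑' m, f (Ψ m ω))) := by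
    simp_rw [← lintegral_count]
    exact lintegral_tendsto_of_tendsto_of_monotone (fun n => Measurable.of_discrete.aemeasurable)
      (ae_of_all _ fun m => hmono _) (ae_of_all _ fun m => hlim _)
  have hleft : Tendsto (fun n => ∫⁻ ω, expNeg (∑' m, F n (Ψ m ω)) ∂P) atTop
      (𝓝 (∫⁻ ω, expNeg (∑' m, f (Ψ m ω)) ∂P)) := by
    refine tendsto_lintegral_of_dominated_convergence (fun _ => 1) (fun n => ?_)
      (fun n => ae_of_all _ fun ω => expNeg_le_one _) (by simp)
      (ae_of_all _ fun ω => (continuous_expNeg.tendsto _).comp (hsum ω))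
    exact measurable_expNeg.comp
      (Measurable.tsum fun m => (F n).measurable.comp (hΨ.measurable m))
  have hright : Tendsto (fun n => expNeg (ENNReal.ofReal lam * ∫⁻ x, (1 - expNeg (F n x)))) atTop
      (𝓝 (expNeg (ENNReal.ofReal lam * ∫⁻ x, (1 - expNeg (f x))))) := by
    refine (continuous_expNeg.tendsto _).comp
      (ENNReal.Tendsto.const_mul ?_ (Or.inr ENNReal.ofReal_ne_top))
    refine lintegral_tendsto_of_tendsto_of_monotone
      (fun n => (measurable_const.sub (measurable_expNeg.comp (F n).measurable)).aemeasurable)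
      (ae_of_all _ fun x m n hmn => tsub_le_tsub_left (antitone_expNeg (hmono x hmn)) _)
      (ae_of_all _ fun x => ?_)
    exact ENNReal.Tendsto.sub tendsto_const_nhds ((continuous_expNeg.tendsto _).comp (hlim x))
      (Or.inl ENNReal.one_ne_top)
  exact tendsto_nhds_unique hleft (by simpa only [hsimple] using hright)

/-- Almost surely no point of the process lies in a given null set. -/
theorem ae_notMem (hΨ : IsHomogeneousPPP P lam Ψ) {B : Set Plane} (hB : MeasurableSet B)
    (hB0 : volume B = 0) : ∀ᵐ ω ∂P, ∀ m, Ψ m ω ∉ B := by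
  have h := (hΨ.poisson B hB (by simp [hB0])).measure_eq (p := (· ≠ 0)) (.of_discrete)
  rw [Measure.map_apply .of_discrete .of_discrete] at h
  have h0 : poissonMeasure 0 {(0 : ℕ)}ᶜ = 0 := by
    rw [prob_compl_eq_zero_iff (measurableSet_singleton _), poissonMeasure_singleton]
    simp
  have hset : (fun n : ℕ => (n : ℕ∞)) ⁻¹' {n | n ≠ 0} = {(0 : ℕ)}ᶜ := by
    ext n
    simp
  rw [hset, hB0, mul_zero, ENNReal.toNNReal_zero, h0] at h
  filter_upwards [measure_eq_zero_iff_ae_notMem.1 h] with ω hω m hm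
  have : pointCount (fun m => Ψ m ω) B = 0 := not_not.1 hω
  exact encard_eq_zero.1 this |>.subset (show m ∈ {m | Ψ m ω ∈ B} from hm)

end IsHomogeneousPPP

/-! ### The functions `g` and `Z` -/

namespace SignalModel

variable (M : SignalModel)

theorem Es_pos : 0 < M.Es :=
  mul_pos (sq_pos_iff.2 M.k₀_ne) M.integral_sq_pos

theorem rho_pos : 0 < M.rho := div_pos M.Es_pos (mul_pos two_pos M.N₀_pos)

theorem We_nonneg : 0 ≤ M.We :=
  mul_nonneg (div_nonneg (sq_nonneg _) M.Es_pos.le) (integral_nonneg fun _ => sq_nonneg _)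

theorem γ_pos : 0 < M.γ := two_pos.trans M.two_lt_γ

theorem bandwidth_nonneg : 0 ≤ 4 * M.We / M.c ^ 2 :=
  div_nonneg (mul_nonneg zero_le_four M.We_nonneg) (sq_nonneg _)

theorem g_nonneg {D : ℝ} (hD : 0 ≤ D) : 0 ≤ M.g D :=
  mul_nonneg (Real.rpow_nonneg hD _)
    (add_nonneg (sq_nonneg _) (mul_nonneg M.bandwidth_nonneg (sq_nonneg _)))

theorem g_pos {D : ℝ} (hD : 0 < D) : 0 < M.g D :=
  mul_pos (Real.rpow_pos_of_pos hD _)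
    (add_pos_of_pos_of_nonneg (pow_pos M.γ_pos 2) (mul_nonneg M.bandwidth_nonneg (sq_nonneg _)))

@[fun_prop]
theorem measurable_g : Measurable M.g := by
  unfold g
  fun_prop

theorem one_sub_exp_mem_Icc {s r : ℝ} (hs : 0 ≤ s) (hr : 0 ≤ r) :
    1 - Real.exp (-(s * M.g r)) ∈ Icc 0 1 := by
  have h : Real.exp (-(s * M.g r)) ≤ 1 :=
    Real.exp_le_one_iff.2 (neg_nonpos.2 (mul_nonneg hs (M.g_nonneg hr)))
  exact ⟨sub_nonneg.2 h, sub_le_self _ (Real.exp_nonneg _)⟩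

theorem g_mul_le {r : ℝ} (hr : 1 ≤ r) :
    M.g r * r ≤ (M.γ ^ 2 + 4 * M.We / M.c ^ 2) * r ^ (1 - M.γ) := by
  have h0 : 0 < r := one_pos.trans_le hr
  have h1 : r ^ (1 - M.γ) = r ^ (-M.γ - 2) * (r ^ 2 * r) := by
    rw [← pow_succ, ← Real.rpow_natCast, ← Real.rpow_add h0]
    congr 1
    push_cast
    ring
  have h2 : M.γ ^ 2 ≤ M.γ ^ 2 * r ^ 2 := le_mul_of_one_le_right (sq_nonneg _) (one_le_pow₀ hr)
  calc
    M.g r * r = r ^ (-M.γ - 2) * r * (M.γ ^ 2 + 4 * M.We / M.c ^ 2 * r ^ 2) := by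
      rw [g]
      ring
    _ ≤ r ^ (-M.γ - 2) * r * (M.γ ^ 2 * r ^ 2 + 4 * M.We / M.c ^ 2 * r ^ 2) := by gcongr
    _ = _ := by
      rw [h1]
      ring

/-- The integral `Z(s)` converges: its integrand is at most `r`, and `O(r ^ (1 - γ))` at infinity,
where `γ > 2`. -/
theorem integrableOn_Z {s : ℝ} (hs : 0 ≤ s) :
    IntegrableOn (fun r : ℝ => (1 - Real.exp (-(s * M.g r))) * r) (Ioi 0) := by
  have hm : Measurable fun r : ℝ => (1 - Real.exp (-(s * M.g r))) * r := by fun_prop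
  rw [← Ioc_union_Ioi_eq_Ioi zero_le_one, integrableOn_union]
  constructor
  · refine Measure.integrableOn_of_bounded (M := 1) (by simp) hm.aestronglyMeasurable ?_
    refine (ae_restrict_iff' measurableSet_Ioc).2 (ae_of_all _ fun r hr => ?_)
    have h := M.one_sub_exp_mem_Icc hs hr.1.le
    rw [Real.norm_of_nonneg (mul_nonneg h.1 hr.1.le)]
    exact mul_le_one₀ h.2 hr.1.le hr.2
  · have hi := ((integrableOn_Ioi_rpow_of_lt (show 1 - M.γ < -1 by linarith [M.two_lt_γ])
      one_pos).const_mul (s * (M.γ ^ 2 + 4 * M.We / M.c ^ 2)))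
    refine Integrable.mono' hi hm.aestronglyMeasurable ?_
    refine (ae_restrict_iff' measurableSet_Ioi).2 (ae_of_all _ fun r (hr : 1 < r) => ?_)
    have h0 : 0 ≤ r := zero_le_one.trans hr.le
    have h := M.one_sub_exp_mem_Icc hs h0
    rw [Real.norm_of_nonneg (mul_nonneg h.1 h0), mul_assoc]
    calc
      _ ≤ s * M.g r * r := by
        gcongr
        linarith [Real.add_one_le_exp (-(s * M.g r))]
      _ = s * (M.g r * r) := by ring
      _ ≤ _ := mul_le_mul_of_nonneg_left (M.g_mul_le hr.le) hs

/-- `Z` grows at least like a positive power of `s`: on the disc of radius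
`R = (γ² s) ^ (1 / (γ + 2))` one has `s g(r) ≥ 1`. -/
theorem le_Z {s : ℝ} (hs : 0 < s) :
    (1 - Real.exp (-1)) / 2 * (M.γ ^ 2) ^ (2 / (M.γ + 2)) * s ^ (2 / (M.γ + 2)) ≤ M.Z s := by
  have hγ := M.γ_pos
  set R : ℝ := (M.γ ^ 2 * s) ^ (1 / (M.γ + 2)) with hR
  have hR0 : 0 < R := by positivity
  have hRsq : R ^ 2 = (M.γ ^ 2) ^ (2 / (M.γ + 2)) * s ^ (2 / (M.γ + 2)) := by
    rw [hR, ← Real.rpow_natCast, ← Real.rpow_mul (by positivity),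
      ← Real.mul_rpow (by positivity) hs.le]
    congr 1
    push_cast
    ring
  have hRγ : R ^ (-M.γ - 2) = (M.γ ^ 2 * s)⁻¹ := by
    rw [hR, ← Real.rpow_mul (by positivity), ← Real.rpow_neg_one]
    congr 1
    field_simp
    ring
  have hg {r : ℝ} (hr : r ∈ Ioc 0 R) : 1 ≤ s * M.g r := by
    have h1 : R ^ (-M.γ - 2) ≤ r ^ (-M.γ - 2) :=
      Real.rpow_le_rpow_of_nonpos hr.1 hr.2 (by linarith)
    have hb := M.bandwidth_nonneg
    calc
      1 = s * ((M.γ ^ 2 * s)⁻¹ * M.γ ^ 2) := by field_simp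
      _ ≤ s * (r ^ (-M.γ - 2) * (M.γ ^ 2 + 4 * M.We / M.c ^ 2 * r ^ 2)) := by
        rw [← hRγ]
        have := Real.rpow_nonneg hr.1.le (-M.γ - 2)
        gcongr
        exact le_add_of_nonneg_right (mul_nonneg hb (sq_nonneg _))
  have hconst : ∫ r in Ioc 0 R, (1 - Real.exp (-1)) * r =
      (1 - Real.exp (-1)) / 2 * R ^ 2 := by
    rw [← intervalIntegral.integral_of_le hR0.le, intervalIntegral.integral_const_mul, integral_id]
    ring
  rw [mul_assoc, ← hRsq, ← hconst, Z]
  calc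
    _ ≤ ∫ r in Ioc 0 R, (1 - Real.exp (-(s * M.g r))) * r := by
      refine setIntegral_mono_on ?_ ((M.integrableOn_Z hs.le).mono_set Ioc_subset_Ioi_self)
        measurableSet_Ioc fun r hr => ?_
      · exact (continuous_const.mul continuous_id).integrableOn_Ioc
      · have := hg hr
        have := hr.1
        gcongr
    _ ≤ _ := by
      refine setIntegral_mono_set (M.integrableOn_Z hs.le) ?_ Ioc_subset_Ioi_self.eventuallyLE
      exact (ae_restrict_iff' measurableSet_Ioi).2 (ae_of_all _ fun r (hr : 0 < r) =>
        mul_nonneg (M.one_sub_exp_mem_Icc hs.le hr.le).1 hr.le)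

theorem measurable_Z : Measurable M.Z := by
  have h : Measurable fun p : ℝ × ℝ => (1 - Real.exp (-(p.1 * M.g p.2))) * p.2 := by fun_prop
  exact (h.stronglyMeasurable.integral_prod_right' (ν := volume.restrict (Ioi 0))).measurable

theorem integrableOn_exp_neg_Z {lam : ℝ} (hlam : 0 < lam) :
    IntegrableOn (fun s : ℝ => Real.exp (-(2 * Real.pi * lam * M.Z s))) (Ioi 0) := by
  have hγ := M.γ_pos
  have hp : 0 < 2 / (M.γ + 2) := by positivity
  have he : 0 < 1 - Real.exp (-1) := sub_pos.2 (Real.exp_lt_one_iff.2 (by norm_num))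
  set b : ℝ := 2 * Real.pi * lam * ((1 - Real.exp (-1)) / 2 * (M.γ ^ 2) ^ (2 / (M.γ + 2))) with hb
  have hb0 : 0 < b := by positivity
  have hi : IntegrableOn (fun s : ℝ => Real.exp (-b * s ^ (2 / (M.γ + 2)))) (Ioi 0) := by
    -- A nonzero Bochner integral certifies integrability.
    by_contra h
    have h1 := integral_exp_neg_mul_rpow hp hb0
    rw [integral_undef h] at h1
    have : 0 < Real.Gamma (1 / (2 / (M.γ + 2)) + 1) := Real.Gamma_pos_of_pos (by positivity)
    have : 0 < b ^ (-1 / (2 / (M.γ + 2))) * Real.Gamma (1 / (2 / (M.γ + 2)) + 1) := by positivity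
    exact this.ne h1
  refine Integrable.mono' hi
    (Real.measurable_exp.comp (M.measurable_Z.const_mul _).neg).aestronglyMeasurable ?_
  refine (ae_restrict_iff' measurableSet_Ioi).2 (ae_of_all _ fun s (hs : 0 < s) => ?_)
  rw [Real.norm_of_nonneg (Real.exp_nonneg _), Real.exp_le_exp, neg_mul, neg_le_neg_iff, hb,
    mul_assoc]
  gcongr
  exact M.le_Z hs

end SignalModel

/-! ### The sum over pairs of sensors -/

/-- The estimate behind the bound: the sum over all ordered pairs equals
`((∑ w)² - (∑ w cos 2φ)² - (∑ w sin 2φ)²) / 2`, and it counts each unordered pair twice. -/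
theorem four_mul_sum_sin_sq_le {ι : Type*} [LinearOrder ι] (s : Finset ι) {w : ι → ℝ}
    (hw : ∀ i, 0 ≤ w i) (φ : ι → ℝ) :
    4 * ∑ i ∈ s, ∑ j ∈ s, (if i < j then w i * w j * Real.sin (φ i - φ j) ^ 2 else 0) ≤
      (∑ i ∈ s, w i) ^ 2 := by
  set F : ι → ι → ℝ := fun i j => w i * w j * Real.sin (φ i - φ j) ^ 2 with hF
  have hF0 (i j : ι) : 0 ≤ F i j := mul_nonneg (mul_nonneg (hw i) (hw j)) (sq_nonneg _)
  have hFs (i j : ι) : F i j = F j i := by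
    simp only [hF]
    rw [← neg_sub (φ j), Real.sin_neg]
    ring
  have hsymm : ∑ i ∈ s, ∑ j ∈ s, (if i < j then F i j else 0) =
      ∑ i ∈ s, ∑ j ∈ s, (if j < i then F i j else 0) := by
    rw [Finset.sum_comm]
    simp_rw [hFs]
  have htwo : 2 * ∑ i ∈ s, ∑ j ∈ s, (if i < j then F i j else 0) ≤ ∑ i ∈ s, ∑ j ∈ s, F i j := by
    rw [two_mul]
    nth_rw 2 [hsymm]
    simp_rw [← Finset.sum_add_distrib]
    gcongr with i _ j _
    rcases lt_trichotomy i j with h | rfl | h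
    · simp [h, h.not_gt]
    · simp [hF0]
    · simp [h, h.not_gt]
  have hall : 2 * ∑ i ∈ s, ∑ j ∈ s, F i j =
      (∑ i ∈ s, w i) ^ 2 - (∑ i ∈ s, w i * Real.cos (2 * φ i)) ^ 2 -
        (∑ i ∈ s, w i * Real.sin (2 * φ i)) ^ 2 := by
    simp_rw [sq, Finset.sum_mul_sum, Finset.mul_sum, ← Finset.sum_sub_distrib]
    refine Finset.sum_congr rfl fun i _ => Finset.sum_congr rfl fun j _ => ?_
    have h := Real.cos_sq_add_sin_sq (φ i - φ j)
    have h2 : Real.cos (2 * φ i) * Real.cos (2 * φ j) + Real.sin (2 * φ i) * Real.sin (2 * φ j) =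
        2 * Real.cos (φ i - φ j) ^ 2 - 1 := by
      rw [← Real.cos_sub, ← Real.cos_two_mul]
      congr 1
      ring
    simp only [hF]
    linear_combination (w i * w j) * h2 + 2 * (w i * w j) * h
  nlinarith [sq_nonneg (∑ i ∈ s, w i * Real.cos (2 * φ i)),
    sq_nonneg (∑ i ∈ s, w i * Real.sin (2 * φ i))]

theorem four_mul_tsum_sin_sq_le {w : ℕ → ℝ} (hw : ∀ i, 0 ≤ w i) (φ : ℕ → ℝ) :
    4 * ∑' m, ∑' j, (if m < j then
        ENNReal.ofReal (w m * w j * Real.sin (φ m - φ j) ^ 2) else 0) ≤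
      (∑' m, ENNReal.ofReal (w m)) ^ 2 := by
  have hterm (m j : ℕ) : (if m < j then
      ENNReal.ofReal (w m * w j * Real.sin (φ m - φ j) ^ 2) else 0) =
      ENNReal.ofReal (if m < j then w m * w j * Real.sin (φ m - φ j) ^ 2 else 0) := by
    split_ifs <;> simp
  have hterm0 (m j : ℕ) :
      0 ≤ (if m < j then w m * w j * Real.sin (φ m - φ j) ^ 2 else 0) := by
    split_ifs
    · exact mul_nonneg (mul_nonneg (hw m) (hw j)) (sq_nonneg _)
    · exact le_rfl
  simp_rw [hterm]
  rw [← ENNReal.tsum_prod, ← ENNReal.tsum_mul_left]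
  refine ENNReal.summable.tsum_le_of_sum_le fun T => ?_
  set S : Finset ℕ := T.image Prod.fst ∪ T.image Prod.snd with hS
  have hT : T ⊆ S ×ˢ S := fun p hp => Finset.mem_product.2
    ⟨Finset.mem_union_left _ (Finset.mem_image_of_mem _ hp),
      Finset.mem_union_right _ (Finset.mem_image_of_mem _ hp)⟩
  calc
    _ ≤ ∑ p ∈ S ×ˢ S, 4 * ENNReal.ofReal
        (if p.1 < p.2 then w p.1 * w p.2 * Real.sin (φ p.1 - φ p.2) ^ 2 else 0) :=
      Finset.sum_le_sum_of_subset hT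
    _ = ENNReal.ofReal (4 * ∑ i ∈ S, ∑ j ∈ S,
        (if i < j then w i * w j * Real.sin (φ i - φ j) ^ 2 else 0)) := by
      rw [← Finset.mul_sum, ENNReal.ofReal_mul zero_le_four, ← Finset.sum_product',
        ENNReal.ofReal_sum_of_nonneg fun p _ => hterm0 p.1 p.2]
      simp
    _ ≤ ENNReal.ofReal ((∑ i ∈ S, w i) ^ 2) :=
      ENNReal.ofReal_le_ofReal (four_mul_sum_sin_sq_le S hw φ)
    _ = (∑ i ∈ S, ENNReal.ofReal (w i)) ^ 2 := by
      rw [ENNReal.ofReal_pow (Finset.sum_nonneg fun i _ => hw i),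
        ENNReal.ofReal_sum_of_nonneg fun i _ => hw i]
    _ ≤ _ := by
      gcongr
      exact ENNReal.sum_le_tsum S

theorem sourceDist_eq_norm (θ p : Plane) : sourceDist θ p = ‖θ - p‖ := by
  simp [sourceDist, EuclideanSpace.norm_eq, Fin.sum_univ_two]

theorem measurable_sourceDist (θ : Plane) : Measurable (sourceDist θ) := by
  rw [funext (sourceDist_eq_norm θ)]
  fun_prop

/-! ### Lower bound for the Cramér–Rao bound and its expectation -/

namespace SignalModel

variable (M : SignalModel)

/-- The hypothesis excludes the form `0 / 0` of the quotient, whose value in `[0, ∞]` is `0`. -/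
theorem le_CRB (θ : Plane) (ψ : ℕ → Plane)
    (h : ∑' m, ENNReal.ofReal (M.g (sourceDist θ (ψ m))) ≠ 0) :
    ENNReal.ofReal (4 / M.rho) * (∑' m, ENNReal.ofReal (M.g (sourceDist θ (ψ m))))⁻¹ ≤
      M.CRB θ ψ := by
  set A := ∑' m, ENNReal.ofReal (M.g (sourceDist θ (ψ m))) with hA
  rcases eq_or_ne A ∞ with h' | h'
  · simp [h']
  have hB := four_mul_tsum_sin_sq_le (w := fun m => M.g (sourceDist θ (ψ m)))
    (fun m => M.g_nonneg (Real.sqrt_nonneg _)) fun m => sourceAngle θ (ψ m)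
  rw [CRB, ← hA, div_eq_inv_mul, ENNReal.ofReal_mul (inv_nonneg.2 M.rho_pos.le), one_div,
    mul_assoc, show ENNReal.ofReal 4 = 4 by simp]
  gcongr
  rw [ENNReal.le_div_iff_mul_le (Or.inr h) (Or.inr h'), mul_right_comm]
  calc
    _ ≤ A ^ 2 * A⁻¹ := by gcongr
    _ = A := by rw [sq, mul_assoc, ENNReal.mul_inv_cancel h h', mul_one]

/-- Integration in polar coordinates around the source. -/
theorem lintegral_one_sub_expNeg {s : ℝ} (hs : 0 ≤ s) (θ : Plane) :
    ∫⁻ x, (1 - expNeg (ENNReal.ofReal (s * M.g (sourceDist θ x)))) =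
      ENNReal.ofReal (2 * Real.pi * M.Z s) := by
  have hvol : volume.real (Metric.ball (0 : Plane) 1) = Real.pi := by
    rw [Measure.real, EuclideanSpace.volume_ball_fin_two]
    simp [Real.pi_nonneg]
  have hint : Integrable fun x : Plane => 1 - Real.exp (-(s * M.g ‖x‖)) := by
    rw [integrable_fun_norm_addHaar volume (f := fun r => 1 - Real.exp (-(s * M.g r)))]
    simpa [mul_comm] using M.integrableOn_Z hs
  have h1 (x : Plane) : 1 - expNeg (ENNReal.ofReal (s * M.g (sourceDist θ x))) =
      ENNReal.ofReal (1 - Real.exp (-(s * M.g ‖θ - x‖))) := by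
    rw [sourceDist_eq_norm,
      one_sub_expNeg_ofReal (mul_nonneg hs (M.g_nonneg (norm_nonneg _)))]
  simp_rw [h1]
  rw [lintegral_sub_left_eq_self (fun x : Plane => ENNReal.ofReal (1 - Real.exp (-(s * M.g ‖x‖)))) θ,
    ← ofReal_integral_eq_lintegral_ofReal hint
      (ae_of_all _ fun x => (M.one_sub_exp_mem_Icc hs (norm_nonneg x)).1),
    integral_fun_norm_addHaar volume fun r => 1 - Real.exp (-(s * M.g r)), hvol]
  simp [Z, mul_comm, mul_left_comm, mul_assoc]

theorem lintegral_expNeg_total {Ω : Type*} [MeasurableSpace Ω] {P : Measure Ω}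
    [IsProbabilityMeasure P] {lam : ℝ} (hlam : 0 < lam) {Ψ : ℕ → Ω → Plane}
    (hΨ : IsHomogeneousPPP P lam Ψ) (θ : Plane) {s : ℝ} (hs : 0 < s) :
    ∫⁻ ω, expNeg (ENNReal.ofReal s * ∑' m, ENNReal.ofReal (M.g (sourceDist θ (Ψ m ω)))) ∂P =
      ENNReal.ofReal (Real.exp (-(2 * Real.pi * lam * M.Z s))) := by
  have hZ : 0 ≤ M.Z s := setIntegral_nonneg measurableSet_Ioi fun r (hr : 0 < r) =>
    mul_nonneg (M.one_sub_exp_mem_Icc hs.le hr.le).1 hr.le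
  have hm : Measurable fun x => ENNReal.ofReal (s * M.g (sourceDist θ x)) :=
    ((M.measurable_g.comp (measurable_sourceDist θ)).const_mul s).ennreal_ofReal
  simp_rw [← ENNReal.tsum_mul_left, ← ENNReal.ofReal_mul hs.le]
  rw [hΨ.lintegral_expNeg_tsum hm, M.lintegral_one_sub_expNeg hs.le, ← ENNReal.ofReal_mul hlam.le,
    expNeg_ofReal (mul_nonneg hlam.le (by have := Real.pi_pos; positivity))]
  congr 3
  ring

end SignalModel

theorem theorem3 {Ω : Type*} [MeasurableSpace Ω] (P : Measure Ω) [IsProbabilityMeasure P]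
    (M : SignalModel) (lam : ℝ) (hlam : 0 < lam) (Ψ : ℕ → Ω → Plane)
    (hΨ : IsHomogeneousPPP P lam Ψ) (θ : Plane) :
    (∀ s : ℝ, 0 < s →
      IntegrableOn (fun r : ℝ => (1 - Real.exp (-(s * M.g r))) * r) (Ioi 0)) ∧
    IntegrableOn (fun s : ℝ => Real.exp (-(2 * Real.pi * lam * M.Z s))) (Ioi 0) ∧
    ENNReal.ofReal (M.CRBLB lam) ≤ M.averageCRB P Ψ θ := by
  refine ⟨fun s hs => M.integrableOn_Z hs.le, M.integrableOn_exp_neg_Z hlam, ?_⟩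
  set A : Ω → ℝ≥0∞ := fun ω => ∑' m, ENNReal.ofReal (M.g (sourceDist θ (Ψ m ω))) with hA
  have hAm : Measurable A := Measurable.tsum fun m =>
    ((M.measurable_g.comp (measurable_sourceDist θ)).comp (hΨ.measurable m)).ennreal_ofReal
  -- Almost surely no sensor is at the source; as `g > 0` elsewhere, the total weight is not `0`.
  have hA0 : ∀ᵐ ω ∂P, A ω ≠ 0 := by
    filter_upwards [hΨ.ae_notMem (measurableSet_singleton θ) (by simp)] with ω hω h0
    have h := ENNReal.tsum_eq_zero.1 h0 0
    refine (M.g_pos ?_).not_ge (ENNReal.ofReal_eq_zero.1 h)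
    rw [sourceDist_eq_norm, norm_pos_iff, sub_ne_zero]
    exact fun h => hω 0 h.symm
  calc
    ENNReal.ofReal (M.CRBLB lam) = ENNReal.ofReal (4 / M.rho) *
        ∫⁻ s in Ioi (0 : ℝ), ENNReal.ofReal (Real.exp (-(2 * Real.pi * lam * M.Z s))) := by
      rw [SignalModel.CRBLB, ENNReal.ofReal_mul (div_nonneg zero_le_four M.rho_pos.le),
        ofReal_integral_eq_lintegral_ofReal (M.integrableOn_exp_neg_Z hlam)
          (ae_of_all _ fun _ => Real.exp_nonneg _)]
    _ = ENNReal.ofReal (4 / M.rho) *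
        ∫⁻ s in Ioi (0 : ℝ), ∫⁻ ω, expNeg (ENNReal.ofReal s * A ω) ∂P := by
      congr 1
      exact setLIntegral_congr_fun measurableSet_Ioi fun s hs =>
        (M.lintegral_expNeg_total hlam hΨ θ hs).symm
    _ = ENNReal.ofReal (4 / M.rho) * ∫⁻ ω, (A ω)⁻¹ ∂P := by
      rw [lintegral_lintegral_swap]
      · simp_rw [lintegral_expNeg_mul]
      · exact (measurable_expNeg.comp (measurable_fst.ennreal_ofReal.mul
          (hAm.comp measurable_snd))).aemeasurable
    _ = ∫⁻ ω, ENNReal.ofReal (4 / M.rho) * (A ω)⁻¹ ∂P :=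
      (lintegral_const_mul _ hAm.inv).symm
    _ ≤ M.averageCRB P Ψ θ := lintegral_mono_ae (hA0.mono fun ω hω => M.le_CRB θ _ hω)
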